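/- **Theorem (Convergence of cIGN in the edge weight continuous model).** Let $W:[0,1]^2\to[0,1]$ be a graphon (symmetric and measurable) with $|W(u_2,v_2)-W(u_1,v_1)|\le A_1(|u_2-u_1|+|v_2-v_1|)$ and let $X:[0,1]\to\mathbb R^d$ be an $A_3$-Lipschitz signal. Write $[W,\mathrm{Diag}(X)]:[0,1]^2\to\mathbb R^{1+d}$ for the function $(u,v)\mapsto (W(u,v),\mathbf 1_{u=v}X(u))$. *Networks.* For a partition $\gamma$ of $\{1,\dots,\ell+m\}$ (the first $\ell$ elements are input axes, the last $m$ output axes), let $T_\gamma$ be the operator from functions on $[0,1]^\ell$ to functions on $[0,1]^m$ given as follows: if $y_a=y_b$ whenever the output axes $a,b$ lie in a common block of $\gamma$, then $(T_\gamma F)(y)=\int F(\iota(y,z))\,dz$, where $z$ has one coordinate, ranging over $[0,1]$, for each block of $\gamma$ containing only input axes, and $\iota(y,z)\in[0,1]^\ell$ assigns to an input axis the coordinate $z_S$ if its block $S$ contains only input axes, and the common value of $y$ on the output axes of its block otherwise; for all other $y$, $(T_\gamma F)(y)=0$. A linear equivariant layer from $d_1$-channel $\ell$-tensors $[0,1]^\ell\to\mathbb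 R^{d_1}$ to $d_2$-channel $m$-tensors $[0,1]^m\to\mathbb R^{d_2}$ is a map $F\mapsto\Big(\sum_{\gamma}\sum_{c\le d_1} c_{\gamma,c,c'}\,T_\gamma F_c+\sum_{\beta} b_{\beta,c'}\mathbf 1[\,y_i=y_j \text{ for all } i,j \text{ in a common block of } \beta\,]\Big)_{c'\le d_2}$ with filter coefficients $c_{\gamma,c,c'}\in\mathbb R$ and (possibly zero) biases $b_{\beta,c'}\in\mathbb R$, where $\gamma$ ranges over the partitions of $\{1,\dots,\ell+m\}$ and $\beta$ over those of $\{1,\dots,m\}$. A cIGN is a map $\Phi_c=h\circ L^{(T)}\circ\sigma_{T-1}\circ L^{(T-1)}\circ\cdots\circ\sigma_1\circ L^{(1)}$, $T\ge1$, on $(1+d)$-channel $2$-tensors, where $h$ and all $L^{(t)}$ are linear equivariant layers with arbitrary tensor orders and channel numbers in between, and the activation functions $\sigma_t:\mathbb R\to\mathbb R$ act entrywise. The output has any fixed order $m$ and channel number $d'$; for $m=0$ the layer $h$ is invariant and $\Phi_c$ takes values in $\mathbb R^{d'}$. Assume that all filter coefficients are bounded by $A_2$ in absolute value, and that every activation satisfies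 $|\sigma(x)-\sigma(y)|\le|x-y|$ and $\sigma(0)=0$. $\|\cdot\|_{L_2}$ is the $L_2$ norm on $[0,1]^m$ with the Euclidean norm on the channels (for $m=0$, the Euclidean norm on $\mathbb R^{d'}$). *Induced graphon and signal.* For points $u_1\le\dots\le u_n$ in $[0,1]$ put $u_{n+1}=1$ and $I_i=(u_i,u_{i+1}]$. The induced piecewise-constant graphon and signal are $(u,v)\mapsto\sum_{i,j}W(u_i,u_j)\mathbf 1_{I_i}(u)\mathbf 1_{I_j}(v)$ and $u\mapsto\sum_i X(u_i)\mathbf 1_{I_i}(u)$. 1. (Fixed grid.) If $W_n,X_n$ are induced from $u_i=\frac{i-1}n$, $1\le i\le n$, then $\|\Phi_c([W,\mathrm{Diag}(X)])-\Phi_c([W_n,\mathrm{Diag}(X_n)])\|_{L_2}\to0$ as $n\to\infty$. 2. (Random sampling.) If for each $n$ the points $u_1\le\dots\le u_n$ are the order statistics of $n$ independent uniform points of $[0,1]$, and $\widetilde W_n,\widetilde X_n$ are induced from them, then $\|\Phi_c([W,\mathrm{Diag}(X)])-\Phi_c([\widetilde W_n,\mathrm{Diag}(\widetilde X_n)])\|_{L_2}\to0$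 in probability as $n\to\infty$. -/

import Mathlib

open MeasureTheory ProbabilityTheory Filter Topology
open scoped ENNReal

noncomputable section

namespace IGN

/-- The set of partitions of a finite set (encoded as equivalence relations) is finite. -/
instance instFiniteSetoid {α : Type*} [Finite α] : Finite (Setoid α) :=
  Finite.of_injective (fun s : Setoid α => fun a b : α => s a b)
    (fun _ _ h => Setoid.ext (fun a b => iff_of_eq (congrFun (congrFun h a) b)))

instance instFintypeSetoid {α : Type*} [Finite α] : Fintype (Setoid α) :=
  Fintype.ofFinite _

/-! ### Graphons, continuous tensors, and the `L₂` norm -/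

/-- A graphon: a symmetric measurable function `[0,1]² → [0,1]`. -/
structure Graphon where
  toFun : unitInterval → unitInterval → ℝ
  measurable : Measurable (fun p : unitInterval × unitInterval => toFun p.1 p.2)
  symm : ∀ u v, toFun u v = toFun v u
  mem_Icc : ∀ u v, toFun u v ∈ Set.Icc (0 : ℝ) 1

/-- A continuous `k`-tensor with `d` channels, i.e. a function `[0,1]^k → ℝ^d`. -/
abbrev Tensor (k d : ℕ) : Type := (Fin k → unitInterval) → Fin d → ℝ

/-- The `L₂` norm of a continuous tensor (Lebesgue measure on `[0,1]^k`, Euclidean norm over the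
channels). For `k = 0` this is the Euclidean norm of a vector of `ℝ^d`. -/
def tensorL2Norm {k d : ℕ} (F : Tensor k d) : ℝ≥0∞ :=
  eLpNorm (fun x => (WithLp.toLp 2 (F x) : EuclideanSpace ℝ (Fin d))) 2 volume

/-! ### Linear equivariant layers -/

section Layers

variable {l m : ℕ}

/-- `y ∈ γ`: the output index `y` satisfies the equivalence pattern that the partition `γ` of the
`l` input axes (`inl`) and the `m` output axes (`inr`) induces on the output axes. -/
def OutputPattern (γ : Setoid (Fin l ⊕ Fin m)) (y : Fin m → unitInterval) : Prop :=
  ∀ a b : Fin m, γ (Sum.inr a) (Sum.inr b) → y a = y b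

/-- The blocks of `γ` that contain input axes only (the reduction axes). -/
def InputBlock (γ : Setoid (Fin l ⊕ Fin m)) : Type :=
  {q : Quotient γ // ∀ b : Fin m, q ≠ Quotient.mk γ (Sum.inr b)}

instance instFiniteInputBlock (γ : Setoid (Fin l ⊕ Fin m)) : Finite (InputBlock γ) :=
  inferInstanceAs (Finite {q : Quotient γ // ∀ b : Fin m, q ≠ Quotient.mk γ (Sum.inr b)})

instance instFintypeInputBlock (γ : Setoid (Fin l ⊕ Fin m)) : Fintype (InputBlock γ) :=
  Fintype.ofFinite _

open Classical in
/-- The index into the input tensor. An input axis that shares its block with an output axis gets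
the coordinate of that output axis (which one does not matter when `OutputPattern γ y`); any other
input axis gets the free variable `z q` of its block `q`. -/
def inputIndex (γ : Setoid (Fin l ⊕ Fin m)) (y : Fin m → unitInterval)
    (z : InputBlock γ → unitInterval) : Fin l → unitInterval := fun a =>
  if h : ∃ b : Fin m, γ (Sum.inl a) (Sum.inr b) then y h.choose
  else z ⟨Quotient.mk γ (Sum.inl a), fun b hb => h ⟨b, Quotient.exact hb⟩⟩

open Classical in
/-- The basis operator `T_γ` from `l`-tensors to `m`-tensors: select the slice of the input given by
`γ`, average it over the blocks that contain input axes only, align the result with the blocks that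
contain input and output axes, replicate it along the blocks that contain output axes only, and put
`0` outside the slice of the output given by `γ`. -/
def basisOp (γ : Setoid (Fin l ⊕ Fin m)) (X : (Fin l → unitInterval) → ℝ) :
    (Fin m → unitInterval) → ℝ := fun y =>
  if OutputPattern γ y then ∫ z : InputBlock γ → unitInterval, X (inputIndex γ y z) else 0

end Layers

/-- A linear equivariant layer from `l`-tensors with `d` channels to `m`-tensors with `d'` channels:
one filter coefficient for each basis operator and each pair of channels, and a bias that is constant
on every equivalence pattern of the output (possibly zero). -/
structure Layer (l d m d' : ℕ) where
  coeff : Setoid (Fin l ⊕ Fin m) → Fin d → Fin d' → ℝ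
  bias : Setoid (Fin m) → Fin d' → ℝ

open Classical in
def Layer.eval {l d m d' : ℕ} (L : Layer l d m d') (X : Tensor l d) : Tensor m d' := fun y c' =>
  (∑ γ : Setoid (Fin l ⊕ Fin m), ∑ c : Fin d,
      L.coeff γ c c' * basisOp γ (fun x => X x c) y) +
    ∑ β : Setoid (Fin m), if (∀ a b : Fin m, β a b → y a = y b) then L.bias β c' else 0

/-- The filter coefficients of the layer are bounded by `A`. -/
def Layer.FilterBound {l d m d' : ℕ} (A : ℝ) (L : Layer l d m d') : Prop :=
  ∀ γ c c', |L.coeff γ c c'| ≤ A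

/-! ### Continuous invariant graph networks -/

/-- An alternating composition `L⁽ᵀ⁾ ∘ σ ∘ ⋯ ∘ σ ∘ L⁽¹⁾`, `T ≥ 1`, of linear equivariant layers and
entrywise activation functions, from `k`-tensors with `d` channels to `k'`-tensors with `d'`
channels; the orders and channel numbers in between are arbitrary. -/
inductive Body : ℕ → ℕ → ℕ → ℕ → Type
  | last {k d k' d' : ℕ} (L : Layer k d k' d') : Body k d k' d'
  | cons {k d k₁ d₁ k' d' : ℕ} (L : Layer k d k₁ d₁) (σ : ℝ → ℝ) (rest : Body k₁ d₁ k' d') :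
      Body k d k' d'

def Body.eval : {k d k' d' : ℕ} → Body k d k' d' → Tensor k d → Tensor k' d'
  | _, _, _, _, .last L, X => L.eval X
  | _, _, _, _, .cons L σ rest, X => rest.eval (fun x c => σ (L.eval X x c))

def Body.FilterBound (A : ℝ) : {k d k' d' : ℕ} → Body k d k' d' → Prop
  | _, _, _, _, .last L => L.FilterBound A
  | _, _, _, _, .cons L _ rest => L.FilterBound A ∧ rest.FilterBound A

/-- All activation functions are normalized Lipschitz. -/
def Body.NormalizedLipschitz : {k d k' d' : ℕ} → Body k d k' d' → Prop
  | _, _, _, _, .last _ => True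
  | _, _, _, _, .cons _ σ rest =>
      ((∀ x y : ℝ, |σ x - σ y| ≤ |x - y|) ∧ σ 0 = 0) ∧ rest.NormalizedLipschitz

/-- A continuous IGN `h ∘ L⁽ᵀ⁾ ∘ σ ∘ ⋯ ∘ σ ∘ L⁽¹⁾` of arbitrary order on `2`-tensors with `d₀`
channels. The last layer `h` maps to `m`-tensors with `d` channels; the case `m = 0` is that of an
invariant layer, with values in `ℝ^d`. -/
structure CIGN (d₀ m d : ℕ) where
  {order : ℕ}
  {channels : ℕ}
  body : Body 2 d₀ order channels
  head : Layer order channels m d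

namespace CIGN

variable {d₀ m d : ℕ}

def eval (Φ : CIGN d₀ m d) (X : Tensor 2 d₀) : Tensor m d := Φ.head.eval (Φ.body.eval X)

def FilterBound (Φ : CIGN d₀ m d) (A : ℝ) : Prop :=
  Φ.body.FilterBound A ∧ Φ.head.FilterBound A

def NormalizedLipschitz (Φ : CIGN d₀ m d) : Prop := Φ.body.NormalizedLipschitz

end CIGN

open Classical in
/-- The input `[W, Diag X]` of a continuous IGN, a `2`-tensor with `1 + d` channels. -/
def input {d : ℕ} (W : unitInterval → unitInterval → ℝ)
    (X : unitInterval → EuclideanSpace ℝ (Fin d)) : Tensor 2 (1 + d) := fun x =>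
  Fin.append (fun _ : Fin 1 => W (x 0) (x 1))
    (fun c : Fin d => if x 0 = x 1 then X (x 0) c else 0)

/-! ### Sampling in the edge weight continuous model -/

section Sampling

variable {n : ℕ}

/-- The cell `(u_i, u_{i+1}]` of a grid `u_1 ≤ ⋯ ≤ u_n` in `[0,1]`, where `u_{n+1} = 1`. -/
def cell (u : Fin n → unitInterval) (i : Fin n) : Set unitInterval :=
  Set.Ioc (u i) (if h : (i : ℕ) + 1 < n then u ⟨(i : ℕ) + 1, h⟩ else 1)

/-- The piecewise-constant graphon induced from `W` and the grid `u`. -/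
def inducedGraphon (W : unitInterval → unitInterval → ℝ) (u : Fin n → unitInterval) :
    unitInterval → unitInterval → ℝ := fun s t =>
  ∑ i, ∑ j, W (u i) (u j) * (cell u i).indicator 1 s * (cell u j).indicator 1 t

/-- The piecewise-constant signal induced from `X` and the grid `u`. -/
def inducedSignal {d : ℕ} (X : unitInterval → EuclideanSpace ℝ (Fin d))
    (u : Fin n → unitInterval) : unitInterval → EuclideanSpace ℝ (Fin d) := fun s =>
  ∑ i, (cell u i).indicator (1 : unitInterval → ℝ) s • X (u i)

/-- The fixed grid `u_i = (i - 1) / n`, `1 ≤ i ≤ n` (here indexed from `0`). -/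
def fixedGrid (n : ℕ) (i : Fin n) : unitInterval :=
  ⟨(i : ℝ) / n, div_nonneg (Nat.cast_nonneg _) (Nat.cast_nonneg _),
    div_le_one_of_le₀ (Nat.cast_le.mpr i.is_lt.le) (Nat.cast_nonneg _)⟩

/-- The order statistics of `n` points, from the smallest to the largest. -/
def orderStat (x : Fin n → unitInterval) : Fin n → unitInterval := x ∘ Tuple.sort x

end Sampling

/-- `‖Φ([W, Diag X]) - Φ([W', Diag X'])‖_{L₂}`, where `W'`, `X'` are induced from the grid `u`. -/
def CIGN.error {d m d' n : ℕ} (Φ : CIGN (1 + d) m d') (W : Graphon)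
    (X : unitInterval → EuclideanSpace ℝ (Fin d)) (u : Fin n → unitInterval) : ℝ≥0∞ :=
  tensorL2Norm (Φ.eval (input W.toFun X) -
    Φ.eval (input (inducedGraphon W.toFun u) (inducedSignal X u)))

end IGN

end

/-!
The error is controlled through a mode of convergence of tensors that equivariant layers preserve.
Almost everywhere convergence on `[0,1]^k` is not enough, since the operators `T_γ` evaluate their
input on diagonals, which are null sets. Instead, `SliceTendsto` asks for convergence almost
everywhere on every diagonal slice, that is, after every identification of the `k` axes with
coordinates of a cube, for uniformly bounded measurable functions.

This is stable under the layers. On a slice of its output, `T_γ` integrates out some of the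
coordinates of a slice of its input, so Fubini's theorem and dominated convergence apply
(`SliceTendsto.basisOp`); sums and Lipschitz activations are immediate, and biases do not depend on
the input. On the slice of all axes, dominated convergence turns `SliceTendsto` into convergence in
`L₂` (`tendsto_tensorL2Norm_sub`).

For the inputs, suppose that the grids become fine, in the sense that the `K`-th one has a point in
each interval `[k / K, (k + 1) / K)` (`FineGrid`). Then the left endpoint of the cell of any `s > 0`
converges to `s`, and continuity of `W` and `X` yields `sliceTendsto_input`. As the number of points
of the `K`-th grid is arbitrary, an argument by contradiction makes this uniform: for every `ε > 0` there
is a `K` such that all `K`-fine grids have error less than `ε`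
(`CIGN.exists_forall_fineGrid_error_lt`). The fixed grid with `n ≥ K` points is `K`-fine, and `n`
independent uniform points are `K`-fine with probability tending to `1`
(`tendsto_measure_not_fineGrid`), which gives the two parts of the theorem.
-/

noncomputable section

namespace IGN

/-! ### Convergence on diagonal slices -/

/-- `F n → G` on all diagonal slices: the functions are measurable and uniformly bounded on
`[0,1]^k`, and for every identification `f` of the `k` axes with coordinates of a cube `[0,1]^J`,
the restrictions along `f` converge almost everywhere on `[0,1]^J`. -/
structure SliceTendsto {k : ℕ} (F : ℕ → (Fin k → unitInterval) → ℝ)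
    (G : (Fin k → unitInterval) → ℝ) : Prop where
  measurable : ∀ n, Measurable (F n)
  measurable_limit : Measurable G
  bounded : ∃ B : ℝ, (∀ n x, ‖F n x‖ ≤ B) ∧ ∀ x, ‖G x‖ ≤ B
  tendsto : ∀ (J : Type) [Fintype J] (f : Fin k → J), ∀ᵐ x : J → unitInterval,
    Tendsto (fun n => F n (x ∘ f)) atTop (𝓝 (G (x ∘ f)))

namespace SliceTendsto

variable {k : ℕ} {F F' : ℕ → (Fin k → unitInterval) → ℝ} {G G' : (Fin k → unitInterval) → ℝ}

theorem const (hG : Measurable G) {B : ℝ} (hB : ∀ x, ‖G x‖ ≤ B) :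
    SliceTendsto (fun _ => G) G :=
  ⟨fun _ => hG, hG, ⟨B, fun _ => hB, hB⟩, fun _ _ _ => ae_of_all _ fun _ => tendsto_const_nhds⟩

theorem add (h : SliceTendsto F G) (h' : SliceTendsto F' G') :
    SliceTendsto (fun n x => F n x + F' n x) (fun x => G x + G' x) := by
  obtain ⟨B, hF, hG⟩ := h.bounded
  obtain ⟨B', hF', hG'⟩ := h'.bounded
  refine ⟨fun n => (h.measurable n).add (h'.measurable n),
    h.measurable_limit.add h'.measurable_limit, ⟨B + B', fun n x => ?_, fun x => ?_⟩,
    fun J _ f => ?_⟩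
  · exact norm_add_le_of_le (hF n x) (hF' n x)
  · exact norm_add_le_of_le (hG x) (hG' x)
  · filter_upwards [h.tendsto J f, h'.tendsto J f] with x hx hx'
    exact hx.add hx'

theorem sum {ι : Type*} (s : Finset ι) {F : ι → ℕ → (Fin k → unitInterval) → ℝ}
    {G : ι → (Fin k → unitInterval) → ℝ} (h : ∀ i ∈ s, SliceTendsto (F i) (G i)) :
    SliceTendsto (fun n x => ∑ i ∈ s, F i n x) (fun x => ∑ i ∈ s, G i x) := by
  classical
  induction s using Finset.induction_on with
  | empty =>
    simpa using const (B := 0) (G := fun _ : Fin k → unitInterval => (0 : ℝ))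
      measurable_const (by simp)
  | insert a s ha ih =>
    simp only [Finset.sum_insert ha]
    exact (h a (Finset.mem_insert_self a s)).add
      (ih fun i hi => h i (Finset.mem_insert_of_mem hi))

theorem comp_lipschitz (h : SliceTendsto F G) {σ : ℝ → ℝ} {C : NNReal} (hσ : LipschitzWith C σ) :
    SliceTendsto (fun n x => σ (F n x)) (fun x => σ (G x)) := by
  obtain ⟨B, hF, hG⟩ := h.bounded
  have hbd : ∀ t : ℝ, ‖t‖ ≤ B → ‖σ t‖ ≤ ‖σ 0‖ + C * B := fun t ht => by
    have h1 : ‖σ t - σ 0‖ ≤ C * ‖t‖ := by simpa using hσ.norm_sub_le t 0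
    have h2 : (C : ℝ) * ‖t‖ ≤ C * B := by gcongr
    linarith [norm_sub_norm_le (σ t) (σ 0)]
  refine ⟨fun n => hσ.continuous.measurable.comp (h.measurable n),
    hσ.continuous.measurable.comp h.measurable_limit,
    ⟨‖σ 0‖ + C * B, fun n x => hbd _ (hF n x), fun x => hbd _ (hG x)⟩, fun J _ f => ?_⟩
  filter_upwards [h.tendsto J f] with x hx
  exact (hσ.continuous.tendsto _).comp hx

theorem const_mul (h : SliceTendsto F G) (a : ℝ) :
    SliceTendsto (fun n x => a * F n x) (fun x => a * G x) :=
  h.comp_lipschitz (lipschitzWith_smul a)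

end SliceTendsto

/-! ### Equivariant layers preserve slicewise convergence -/

section BasisOp

variable {l m : ℕ} (γ : Setoid (Fin l ⊕ Fin m))

open Classical in
/-- The coordinate that `inputIndex γ` reads off at an input axis: an output axis of the same block
if there is one, and the block itself otherwise. -/
def inputAxis (a : Fin l) : Fin m ⊕ InputBlock γ :=
  if h : ∃ b : Fin m, γ (Sum.inl a) (Sum.inr b) then Sum.inl h.choose
  else Sum.inr ⟨Quotient.mk γ (Sum.inl a), fun b hb => h ⟨b, Quotient.exact hb⟩⟩

theorem inputIndex_eq_comp (y : Fin m → unitInterval) (z : InputBlock γ → unitInterval) :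
    inputIndex γ y z = Sum.elim y z ∘ inputAxis γ := by
  funext a
  by_cases h : ∃ b : Fin m, γ (Sum.inl a) (Sum.inr b)
  · simp [inputIndex, inputAxis, h]
  · simp only [inputIndex, inputAxis, h, Function.comp_apply, dite_false]
    rfl

theorem measurable_inputIndex :
    Measurable fun p : (Fin m → unitInterval) × (InputBlock γ → unitInterval) =>
      inputIndex γ p.1 p.2 := by
  simp only [inputIndex_eq_comp]
  refine measurable_pi_lambda _ fun a => ?_
  rcases h : inputAxis γ a with b | q
  · simp only [Function.comp_apply, h, Sum.elim_inl]
    fun_prop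
  · simp only [Function.comp_apply, h, Sum.elim_inr]
    fun_prop

theorem measurableSet_pattern (β : Setoid (Fin m)) :
    MeasurableSet {y : Fin m → unitInterval | ∀ a b : Fin m, β a b → y a = y b} := by
  simp only [Set.ofPred_forall]
  exact MeasurableSet.iInter fun a => MeasurableSet.iInter fun b => MeasurableSet.iInter fun _ =>
    measurableSet_eq_fun (measurable_pi_apply a) (measurable_pi_apply b)

theorem measurable_basisOp {F : (Fin l → unitInterval) → ℝ} (hF : Measurable F) :
    Measurable (basisOp γ F) := by
  refine Measurable.ite (measurableSet_pattern (γ.comap Sum.inr)) ?_ measurable_const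
  exact (StronglyMeasurable.integral_prod_right (f := fun y z => F (inputIndex γ y z))
    (hF.comp (measurable_inputIndex γ)).stronglyMeasurable).measurable

theorem norm_basisOp_le {F : (Fin l → unitInterval) → ℝ} {B : ℝ} (hF : ∀ x, ‖F x‖ ≤ B)
    (y : Fin m → unitInterval) : ‖basisOp γ F y‖ ≤ B := by
  have hB : 0 ≤ B := (norm_nonneg _).trans (hF fun _ => 0)
  unfold basisOp
  split_ifs
  · simpa using norm_integral_le_of_norm_le_const
      (ae_of_all (volume : Measure (InputBlock γ → unitInterval)) fun z => hF (inputIndex γ y z))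
  · simpa using hB

/-- The operator `T_γ` preserves slicewise convergence: on a slice of the output, it integrates
some of the coordinates of a slice of the input with more coordinates. -/
theorem SliceTendsto.basisOp {F : ℕ → (Fin l → unitInterval) → ℝ}
    {G : (Fin l → unitInterval) → ℝ} (h : SliceTendsto F G) :
    SliceTendsto (fun n => IGN.basisOp γ (F n)) (IGN.basisOp γ G) := by
  obtain ⟨B, hF, hG⟩ := h.bounded
  refine ⟨fun n => measurable_basisOp γ (h.measurable n), measurable_basisOp γ h.measurable_limit,
    ⟨B, fun n => norm_basisOp_le γ (hF n), norm_basisOp_le γ hG⟩, fun J _ f => ?_⟩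
  have hslice := (volume_measurePreserving_sumPiEquivProdPi_symm
    (fun _ : J ⊕ InputBlock γ => unitInterval)).quasiMeasurePreserving.ae
      (h.tendsto (J ⊕ InputBlock γ) (Sum.map f id ∘ inputAxis γ))
  have hcomp : ∀ (x : J → unitInterval) (z : InputBlock γ → unitInterval),
      (MeasurableEquiv.sumPiEquivProdPi fun _ : J ⊕ InputBlock γ => unitInterval).symm (x, z) ∘
        (Sum.map f id ∘ inputAxis γ) = inputIndex γ (x ∘ f) z := fun x z => by
    rw [inputIndex_eq_comp, ← Function.comp_assoc]
    congr 1
    funext s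
    rcases s with b | q <;> rfl
  filter_upwards [Measure.ae_ae_of_ae_prod hslice] with x hx
  simp only [hcomp] at hx
  unfold IGN.basisOp
  split_ifs
  · refine tendsto_integral_of_dominated_convergence (fun _ => B) (fun n => ?_)
      (integrable_const B) (fun n => ae_of_all _ fun z => hF n _) hx
    exact ((h.measurable n).comp ((measurable_inputIndex γ).comp
      (measurable_prodMk_left (x := x ∘ f)))).aestronglyMeasurable
  · exact tendsto_const_nhds

end BasisOp

theorem Layer.sliceTendsto_eval {l d m d' : ℕ} (L : Layer l d m d') {F : ℕ → Tensor l d}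
    {G : Tensor l d} (h : ∀ c, SliceTendsto (fun n x => F n x c) (fun x => G x c)) (c' : Fin d') :
    SliceTendsto (fun n y => L.eval (F n) y c') (fun y => L.eval G y c') := by
  unfold Layer.eval
  refine SliceTendsto.add (SliceTendsto.sum _ fun γ _ => SliceTendsto.sum _ fun c _ =>
    ((h c).basisOp γ).const_mul _) (SliceTendsto.sum _ fun β _ => ?_)
  refine SliceTendsto.const (B := ‖L.bias β c'‖)
    (Measurable.ite (measurableSet_pattern β) measurable_const measurable_const) fun y => ?_
  split_ifs <;> simp

theorem Body.sliceTendsto_eval {k d k' d' : ℕ} (b : Body k d k' d') (hb : b.NormalizedLipschitz)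
    {F : ℕ → Tensor k d} {G : Tensor k d}
    (h : ∀ c, SliceTendsto (fun n x => F n x c) (fun x => G x c)) (c' : Fin d') :
    SliceTendsto (fun n y => b.eval (F n) y c') (fun y => b.eval G y c') := by
  induction b with
  | last L => exact L.sliceTendsto_eval h c'
  | cons L σ rest ih =>
    have hσ : LipschitzWith 1 σ := LipschitzWith.of_dist_le_mul fun x y => by
      simpa [Real.dist_eq] using hb.1.1 x y
    exact ih hb.2 (fun c => (L.sliceTendsto_eval h c).comp_lipschitz hσ) c'

theorem CIGN.sliceTendsto_eval {d₀ m d : ℕ} (Φ : CIGN d₀ m d) (hΦ : Φ.NormalizedLipschitz)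
    {F : ℕ → Tensor 2 d₀} {G : Tensor 2 d₀}
    (h : ∀ c, SliceTendsto (fun n x => F n x c) (fun x => G x c)) (c' : Fin d) :
    SliceTendsto (fun n y => Φ.eval (F n) y c') (fun y => Φ.eval G y c') :=
  Φ.head.sliceTendsto_eval (fun c => Φ.body.sliceTendsto_eval hΦ h c) c'

/-- Slicewise convergence implies `L₂` convergence: take the slice of all axes and use dominated
convergence. -/
theorem tendsto_tensorL2Norm_sub {k d : ℕ} {F : ℕ → Tensor k d} {G : Tensor k d}
    (h : ∀ c, SliceTendsto (fun n x => F n x c) (fun x => G x c)) :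
    Tendsto (fun n => tensorL2Norm (G - F n)) atTop (𝓝 0) := by
  choose B hF hG using fun c => (h c).bounded
  let D : ℕ → (Fin k → unitInterval) → EuclideanSpace ℝ (Fin d) :=
    fun n x => WithLp.toLp 2 ((G - F n) x)
  have hnorm : ∀ n x, ‖D n x‖ = √(∑ c, (G x c - F n x c) ^ 2) := fun n x => by
    simp [D, EuclideanSpace.norm_eq]
  have hmeas : ∀ n, Measurable fun x => ‖D n x‖ₑ ^ (2 : ℝ) := fun n => by
    have : Measurable fun x => ‖D n x‖ := by
      simp only [hnorm]
      exact (Finset.measurable_sum _ fun c _ =>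
        ((h c).measurable_limit.sub ((h c).measurable n)).pow_const 2).sqrt
    simpa only [ofReal_norm] using this.ennreal_ofReal.pow_const 2
  have hbound : ∀ n x, ‖D n x‖ₑ ^ (2 : ℝ) ≤
      ENNReal.ofReal (√(∑ c, (B c + B c) ^ 2)) ^ (2 : ℝ) := fun n x => by
    rw [← ofReal_norm, hnorm]
    refine ENNReal.rpow_le_rpow (ENNReal.ofReal_le_ofReal (Real.sqrt_le_sqrt
      (Finset.sum_le_sum fun c _ => sq_le_sq.2 ?_))) (by norm_num)
    exact (norm_sub_le_of_le (hG c x) (hF c n x)).trans (le_abs_self _)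
  have hlim : ∀ᵐ x : Fin k → unitInterval,
      Tendsto (fun n => ‖D n x‖ₑ ^ (2 : ℝ)) atTop (𝓝 0) := by
    filter_upwards [ae_all_iff.2 fun c => (h c).tendsto (Fin k) id] with x hx
    have h0 : Tendsto (fun n => ‖D n x‖) atTop (𝓝 0) := by
      simp only [hnorm]
      have : Tendsto (fun n => √(∑ c, (G x c - F n x c) ^ 2)) atTop
          (𝓝 √(∑ c, (G x c - G x c) ^ 2)) :=
        (tendsto_finsetSum _ fun c _ => (tendsto_const_nhds.sub (hx c)).pow 2).sqrt
      simpa using this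
    have h1 := (ENNReal.tendsto_ofReal h0).ennrpow_const 2
    simpa [ofReal_norm] using h1
  have hint := tendsto_lintegral_of_dominated_convergence
    (fun _ => ENNReal.ofReal (√(∑ c, (B c + B c) ^ 2)) ^ (2 : ℝ)) hmeas
    (fun n => ae_of_all _ (hbound n)) (by simp) hlim
  have := hint.ennrpow_const (1 / 2)
  have hz : ((0 : ℝ≥0∞)) ^ (1 / 2 : ℝ) = 0 := ENNReal.zero_rpow_of_pos (by norm_num)
  simpa [tensorL2Norm, eLpNorm_eq_lintegral_rpow_enorm_toReal, D, hz] using this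

/-! ### Induced graphons and signals along fine grids -/

section Grid

variable {n : ℕ} {u : Fin n → unitInterval} {s t : unitInterval}

theorem cell_unique (hu : Monotone u) {i j : Fin n} (hi : s ∈ cell u i) (hj : s ∈ cell u j) :
    i = j := by
  have key : ∀ {i j : Fin n}, s ∈ cell u i → s ∈ cell u j → ¬ i < j := by
    intro i j hi hj hij
    have hn : (i : ℕ) + 1 < n := lt_of_le_of_lt hij j.is_lt
    have h1 : s ≤ u ⟨i + 1, hn⟩ := by simpa [hn] using hi.2
    exact absurd (hj.1.trans_le (h1.trans (hu hij))) (lt_irrefl _)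
  exact le_antisymm (not_lt.1 (key hj hi)) (not_lt.1 (key hi hj))

theorem exists_mem_cell (hu : Monotone u) {j : Fin n} (hj : u j < s) :
    ∃ i, u j ≤ u i ∧ s ∈ cell u i := by
  classical
  obtain ⟨i, hji, hi⟩ := (Set.toFinite {i | u i < s}).exists_le_maximal hj
  refine ⟨i, hu hji, hi.prop, ?_⟩
  split_ifs with h
  · by_contra! hlt
    have : (⟨i + 1, h⟩ : Fin n) ≤ i := hi.le_of_ge hlt (Fin.mk_le_mk.2 (Nat.le_succ i))
    exact absurd (Fin.mk_le_mk.1 this) (by simp)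
  · exact unitInterval.le_one'

theorem inducedSignal_eq {d : ℕ} (X : unitInterval → EuclideanSpace ℝ (Fin d)) (hu : Monotone u)
    {i : Fin n} (hs : s ∈ cell u i) : inducedSignal X u s = X (u i) := by
  unfold inducedSignal
  rw [Finset.sum_eq_single i (fun j _ hj => ?_) (by simp)]
  · simp [hs]
  · have : s ∉ cell u j := fun h => hj (cell_unique hu h hs)
    simp [this]

theorem inducedSignal_eq_zero {d : ℕ} (X : unitInterval → EuclideanSpace ℝ (Fin d))
    (hs : ∀ i, s ∉ cell u i) : inducedSignal X u s = 0 := by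
  simp [inducedSignal, hs]

theorem inducedGraphon_eq (W : unitInterval → unitInterval → ℝ) (hu : Monotone u)
    {i j : Fin n} (hs : s ∈ cell u i) (ht : t ∈ cell u j) :
    inducedGraphon W u s t = W (u i) (u j) := by
  unfold inducedGraphon
  rw [Finset.sum_eq_single i (fun k _ hk => ?_) (by simp),
    Finset.sum_eq_single j (fun k _ hk => ?_) (by simp)]
  · simp [hs, ht]
  · have : t ∉ cell u k := fun h => hk (cell_unique hu h ht)
    simp [this]
  · have : s ∉ cell u k := fun h => hk (cell_unique hu h hs)
    simp [this]

theorem inducedGraphon_eq_zero (W : unitInterval → unitInterval → ℝ)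
    (h : (∀ i, s ∉ cell u i) ∨ ∀ j, t ∉ cell u j) : inducedGraphon W u s t = 0 := by
  rcases h with h | h <;> simp [inducedGraphon, h]

theorem norm_inducedSignal_le {d : ℕ} {X : unitInterval → EuclideanSpace ℝ (Fin d)} {B : ℝ}
    (hX : ∀ s, ‖X s‖ ≤ B) (hu : Monotone u) (s : unitInterval) : ‖inducedSignal X u s‖ ≤ B := by
  by_cases hs : ∃ i, s ∈ cell u i
  · obtain ⟨i, hi⟩ := hs
    exact inducedSignal_eq X hu hi ▸ hX _
  · rw [inducedSignal_eq_zero X (not_exists.1 hs), norm_zero]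
    exact (norm_nonneg _).trans (hX 0)

theorem norm_inducedGraphon_le {W : unitInterval → unitInterval → ℝ} {B : ℝ}
    (hW : ∀ s t, ‖W s t‖ ≤ B) (hu : Monotone u) (s t : unitInterval) :
    ‖inducedGraphon W u s t‖ ≤ B := by
  by_cases h : (∃ i, s ∈ cell u i) ∧ ∃ j, t ∈ cell u j
  · obtain ⟨⟨i, hi⟩, j, hj⟩ := h
    exact inducedGraphon_eq W hu hi hj ▸ hW _ _
  · rw [inducedGraphon_eq_zero W (by simpa only [not_and_or, not_exists] using h), norm_zero]
    exact (norm_nonneg _).trans (hW 0 0)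

theorem measurable_indicator_cell (u : Fin n → unitInterval) (i : Fin n) :
    Measurable ((cell u i).indicator (1 : unitInterval → ℝ)) :=
  measurable_one.indicator measurableSet_Ioc

theorem measurable_inducedSignal {d : ℕ} (X : unitInterval → EuclideanSpace ℝ (Fin d))
    (u : Fin n → unitInterval) : Measurable (inducedSignal X u) :=
  Finset.measurable_sum _ fun i _ => (measurable_indicator_cell u i).smul_const _

theorem measurable_inducedGraphon (W : unitInterval → unitInterval → ℝ)
    (u : Fin n → unitInterval) :
    Measurable fun p : unitInterval × unitInterval => inducedGraphon W u p.1 p.2 :=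
  Finset.measurable_sum _ fun i _ => Finset.measurable_sum _ fun j _ =>
    (((measurable_indicator_cell u i).comp measurable_fst).const_mul _).mul
      ((measurable_indicator_cell u j).comp measurable_snd)

/-- Every interval `[k / K, (k + 1) / K)`, `k < K`, contains a point of the grid. -/
def FineGrid (K : ℕ) (u : Fin n → unitInterval) : Prop :=
  ∀ k < K, ∃ i, u i ∈ {t : unitInterval | (k : ℝ) / K ≤ t ∧ (t : ℝ) < (k + 1) / K}

theorem FineGrid.orderStat {K : ℕ} (hK : FineGrid K u) : FineGrid K (orderStat u) := fun k hk => by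
  obtain ⟨i, hi⟩ := hK k hk
  exact ⟨(Tuple.sort u).symm i, by simpa [IGN.orderStat] using hi⟩

theorem fineGrid_fixedGrid {K : ℕ} (hK : K ≤ n) : FineGrid K (fixedGrid n) := fun k hk => by
  have hK0 : (0 : ℝ) < K := by exact_mod_cast (Nat.zero_le k).trans_lt hk
  have hn0 : (0 : ℝ) < n := hK0.trans_le (by exact_mod_cast hK)
  have hkK : (k : ℝ) + 1 ≤ K := by exact_mod_cast hk
  have hKn : (K : ℝ) ≤ n := by exact_mod_cast hK
  have h1 := Nat.le_ceil ((k : ℝ) * n / K)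
  have h2 := Nat.ceil_lt_add_one (show 0 ≤ (k : ℝ) * n / K by positivity)
  set i := ⌈(k : ℝ) * n / K⌉₊
  rw [div_le_iff₀ hK0] at h1
  have h3 : (i : ℝ) * K < (k + 1) * n := by
    have : (i : ℝ) * K < ((k : ℝ) * n / K + 1) * K := by gcongr
    have h4 : ((k : ℝ) * n / K + 1) * K = k * n + K := by field_simp
    linarith
  have hi : i < n := by
    have : (i : ℝ) * K < n * K := h3.trans_le (by rw [mul_comm]; gcongr)
    exact_mod_cast lt_of_mul_lt_mul_right this hK0.le
  refine ⟨⟨i, hi⟩, ?_, ?_⟩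
  · simp only [fixedGrid]
    rw [div_le_div_iff₀ hK0 hn0]
    exact h1
  · simp only [fixedGrid]
    rw [div_lt_div_iff₀ hn0 hK0]
    exact h3

theorem FineGrid.exists_mem_cell {K : ℕ} (hK : FineGrid K u) (hu : Monotone u) (hK0 : 0 < K)
    (hs : 2 / (K : ℝ) ≤ s) : ∃ i, s ∈ cell u i ∧ (u i : ℝ) ∈ Set.Icc ((s : ℝ) - 2 / K) s := by
  have hK0' : (0 : ℝ) < K := by exact_mod_cast hK0
  have h2 : (2 : ℝ) ≤ s * K := (div_le_iff₀ hK0').1 hs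
  -- The grid has a point in the last interval of length `1 / K` that ends before `s`.
  obtain ⟨k, hk⟩ : ∃ k, ⌈(s : ℝ) * K⌉₊ = k + 2 :=
    Nat.exists_eq_add_of_le' (by exact_mod_cast h2.trans (Nat.le_ceil _))
  have hle := Nat.le_ceil ((s : ℝ) * K)
  have hlt := Nat.ceil_lt_add_one (show 0 ≤ (s : ℝ) * K by linarith)
  have hkK : k + 2 ≤ K := by
    rw [← hk]
    exact Nat.ceil_le.2 (mul_le_of_le_one_left hK0'.le s.2.2)
  rw [hk] at hle hlt
  push_cast at hle hlt
  obtain ⟨j, hj1, hj2⟩ := hK k (by omega)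
  have hjs : u j < s := by
    refine Subtype.coe_lt_coe.1 (hj2.trans ?_)
    rw [div_lt_iff₀ hK0']
    linarith
  obtain ⟨i, hji, hi⟩ := IGN.exists_mem_cell hu hjs
  refine ⟨i, hi, ?_, Subtype.coe_le_coe.2 hi.1.le⟩
  have h3 : (s : ℝ) - 2 / K ≤ k / K := by
    rw [sub_le_iff_le_add, ← add_div, le_div_iff₀ hK0']
    exact hle
  exact h3.trans (hj1.trans (Subtype.coe_le_coe.2 hji))

end Grid

section Limit

variable {N : ℕ → ℕ} {u : (K : ℕ) → Fin (N K) → unitInterval}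

/-- Along ever finer grids, the left endpoints of the cells of a point `s > 0` converge to `s`.
At `s = 0` this fails, since the cells are open on the left. -/
theorem exists_tendsto_left_endpoints (hu : ∀ K, Monotone (u K)) (hfine : ∀ K, FineGrid K (u K))
    {s : unitInterval} (hs : s ≠ 0) :
    ∃ p : ℕ → unitInterval, Tendsto p atTop (𝓝 s) ∧
      ∀ᶠ K in atTop, ∃ i, s ∈ cell (u K) i ∧ p K = u K i := by
  have hlim : Tendsto (fun K : ℕ => 2 / (K : ℝ)) atTop (𝓝 0) :=
    tendsto_const_div_atTop_nhds_zero_nat 2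
  have hs0 : (0 : ℝ) < s := unitInterval.pos_iff_ne_zero.2 hs
  have hev : ∀ᶠ K : ℕ in atTop, ∃ p : unitInterval, (∃ i, s ∈ cell (u K) i ∧ p = u K i) ∧
      (p : ℝ) ∈ Set.Icc ((s : ℝ) - 2 / K) s := by
    filter_upwards [eventually_gt_atTop 0, hlim.eventually_le_const hs0] with K hK0 hK
    obtain ⟨i, hi, hb⟩ := (hfine K).exists_mem_cell (hu K) hK0 hK
    exact ⟨u K i, ⟨i, hi, rfl⟩, hb⟩
  obtain ⟨p, hp⟩ := hev.choice
  refine ⟨p, tendsto_subtype_rng.2 (tendsto_of_tendsto_of_tendsto_of_le_of_le'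
    (by simpa using hlim.const_sub (s : ℝ)) tendsto_const_nhds
    (hp.mono fun K h => h.2.1) (hp.mono fun K h => h.2.2)), hp.mono fun K h => h.1⟩

theorem tendsto_inducedSignal {d : ℕ} {X : unitInterval → EuclideanSpace ℝ (Fin d)}
    (hX : Continuous X) (hu : ∀ K, Monotone (u K)) (hfine : ∀ K, FineGrid K (u K))
    {s : unitInterval} (hs : s ≠ 0) :
    Tendsto (fun K => inducedSignal X (u K) s) atTop (𝓝 (X s)) := by
  obtain ⟨p, hp, hev⟩ := exists_tendsto_left_endpoints hu hfine hs
  refine ((hX.tendsto s).comp hp).congr' ?_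
  filter_upwards [hev] with K ⟨i, hi, hpi⟩
  simp [inducedSignal_eq X (hu K) hi, hpi]

theorem tendsto_inducedGraphon {W : unitInterval → unitInterval → ℝ}
    (hW : Continuous (Function.uncurry W)) (hu : ∀ K, Monotone (u K))
    (hfine : ∀ K, FineGrid K (u K)) {s t : unitInterval} (hs : s ≠ 0) (ht : t ≠ 0) :
    Tendsto (fun K => inducedGraphon W (u K) s t) atTop (𝓝 (W s t)) := by
  obtain ⟨p, hp, hev⟩ := exists_tendsto_left_endpoints hu hfine hs
  obtain ⟨q, hq, hev'⟩ := exists_tendsto_left_endpoints hu hfine ht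
  refine ((hW.tendsto (s, t)).comp (hp.prodMk_nhds hq)).congr' ?_
  filter_upwards [hev, hev'] with K ⟨i, hi, hpi⟩ ⟨j, hj, hqj⟩
  simp [inducedGraphon_eq W (hu K) hi hj, hpi, hqj]

theorem sliceTendsto_input {d : ℕ} {W : unitInterval → unitInterval → ℝ}
    {X : unitInterval → EuclideanSpace ℝ (Fin d)} (hW : Continuous (Function.uncurry W))
    (hX : Continuous X) (hu : ∀ K, Monotone (u K)) (hfine : ∀ K, FineGrid K (u K))
    (c : Fin (1 + d)) :
    SliceTendsto (fun K x => input (inducedGraphon W (u K)) (inducedSignal X (u K)) x c)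
      (fun x => input W X x c) := by
  have hpair : Measurable fun x : Fin 2 → unitInterval => (x 0, x 1) := by fun_prop
  have hne : ∀ (J : Type) [Fintype J], ∀ᵐ x : J → unitInterval, ∀ i, x i ≠ 0 := fun J _ =>
    ae_all_iff.2 fun i => Measure.ae_eval_ne (fun _ => volume) i 0
  induction c using Fin.addCases with
  | left c =>
    simp only [input, Fin.append_left]
    obtain ⟨B, hB⟩ := isCompact_univ.exists_bound_of_continuousOn hW.continuousOn
    have hB' : ∀ s t, ‖W s t‖ ≤ B := fun s t => hB (s, t) (Set.mem_univ _)
    have hmeas : ∀ V : unitInterval → unitInterval → ℝ,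
        Measurable (fun p : unitInterval × unitInterval => V p.1 p.2) →
        Measurable fun x : Fin 2 → unitInterval => V (x 0) (x 1) := fun V hV => hV.comp hpair
    refine ⟨fun K => hmeas _ (measurable_inducedGraphon W (u K)), hmeas W hW.measurable,
      ⟨B, fun K x => norm_inducedGraphon_le hB' (hu K) _ _, fun x => hB' _ _⟩, fun J _ f => ?_⟩
    filter_upwards [hne J] with x hx
    exact tendsto_inducedGraphon hW hu hfine (hx _) (hx _)
  | right c =>
    simp only [input, Fin.append_right]
    obtain ⟨B, hB⟩ := isCompact_univ.exists_bound_of_continuousOn hX.continuousOn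
    have hdiag : MeasurableSet {x : Fin 2 → unitInterval | x 0 = x 1} :=
      measurableSet_eq_fun (measurable_pi_apply 0) (measurable_pi_apply 1)
    have hmeas : ∀ {Y : unitInterval → EuclideanSpace ℝ (Fin d)}, Measurable Y →
        Measurable fun x : Fin 2 → unitInterval => if x 0 = x 1 then Y (x 0) c else 0 :=
      fun {Y} hY => Measurable.ite hdiag (by fun_prop) measurable_const
    have hbdd : ∀ {Y : unitInterval → EuclideanSpace ℝ (Fin d)}, (∀ s, ‖Y s‖ ≤ B) →
        ∀ x : Fin 2 → unitInterval, ‖if x 0 = x 1 then Y (x 0) c else 0‖ ≤ B := fun {Y} hY x => by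
      split_ifs
      · exact (PiLp.norm_apply_le _ _).trans (hY _)
      · simpa using (norm_nonneg _).trans (hY 0)
    have hBX : ∀ s, ‖X s‖ ≤ B := fun s => hB s (Set.mem_univ s)
    refine ⟨fun K => hmeas (measurable_inducedSignal X (u K)), hmeas hX.measurable,
      ⟨B, fun K => hbdd (norm_inducedSignal_le hBX (hu K)), hbdd hBX⟩, fun J _ f => ?_⟩
    filter_upwards [hne J] with x hx
    split_ifs
    · have hproj : Continuous fun v : EuclideanSpace ℝ (Fin d) => v c := by fun_prop
      exact (hproj.tendsto (X (x (f 0)))).comp (tendsto_inducedSignal hX hu hfine (hx (f 0)))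
    · exact tendsto_const_nhds

end Limit

/-- The error of a network is small on all sufficiently fine grids, whatever their number of
points. -/
theorem CIGN.exists_forall_fineGrid_error_lt {d m d' : ℕ} (Φ : CIGN (1 + d) m d')
    (hΦ : Φ.NormalizedLipschitz) (W : Graphon) (hW : Continuous (Function.uncurry W.toFun))
    {X : unitInterval → EuclideanSpace ℝ (Fin d)} (hX : Continuous X) {ε : ℝ≥0∞} (hε : 0 < ε) :
    ∃ K : ℕ, ∀ (n : ℕ) (u : Fin n → unitInterval), Monotone u → FineGrid K u →
      Φ.error W X u < ε := by
  by_contra! h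
  choose N u hu hfine herr using h
  have hlim : Tendsto (fun K => Φ.error W X (u K)) atTop (𝓝 0) :=
    tendsto_tensorL2Norm_sub fun c =>
      Φ.sliceTendsto_eval hΦ (sliceTendsto_input hW hX hu hfine) c
  obtain ⟨K, hK⟩ := (hlim.eventually_lt_const hε).exists
  exact absurd hK (not_lt.2 (herr K))

/-! ### Random grids -/

theorem measure_interval_compl_lt_one {k K : ℕ} (hk : k < K) :
    volume {t : unitInterval | (k : ℝ) / K ≤ t ∧ (t : ℝ) < (k + 1) / K}ᶜ < 1 := by
  have hK0 : (0 : ℝ) < K := by exact_mod_cast (Nat.zero_le k).trans_lt hk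
  have hkK : (k : ℝ) + 1 ≤ K := by exact_mod_cast hk
  let a : unitInterval := ⟨k / K, by positivity, (div_le_one hK0).2 (by linarith)⟩
  let b : unitInterval := ⟨(k + 1) / K, by positivity, (div_le_one hK0).2 hkK⟩
  have hab : {t : unitInterval | (k : ℝ) / K ≤ t ∧ (t : ℝ) < (k + 1) / K} = Set.Ico a b := rfl
  have hlt : (a : ℝ) < b := div_lt_div_of_pos_right (lt_add_one _) hK0
  rw [hab, prob_compl_eq_one_sub measurableSet_Ico, unitInterval.volume_Ico]
  exact ENNReal.sub_lt_self ENNReal.one_ne_top one_ne_zero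
    (ENNReal.ofReal_pos.2 (sub_pos.2 hlt)).ne'

/-- With high probability, independent uniform points form a fine grid: each of the finitely many
intervals is missed with a probability that is exponentially small. -/
theorem tendsto_measure_not_fineGrid {Ω : Type*} [MeasurableSpace Ω] (P : Measure Ω)
    (ξ : (n : ℕ) → Fin n → Ω → unitInterval) (hlaw : ∀ n i, HasLaw (ξ n i) volume P)
    (hind : ∀ n, iIndepFun (ξ n) P) (K : ℕ) :
    Tendsto (fun n : ℕ => P {ω | ¬ FineGrid K fun i => ξ n i ω}) atTop (𝓝 0) := by
  let S : ℕ → Set unitInterval := fun k => {t | (k : ℝ) / K ≤ t ∧ (t : ℝ) < (k + 1) / K}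
  have hS : ∀ k, MeasurableSet (S k) := fun k =>
    (measurableSet_le measurable_const measurable_subtype_coe).inter
      (measurableSet_lt measurable_subtype_coe measurable_const)
  have hmiss : ∀ n k, P (⋂ i, ξ n i ⁻¹' (S k)ᶜ) = volume (S k)ᶜ ^ n := fun n k => by
    rw [(hind n).meas_iInter fun i => ⟨_, (hS k).compl, rfl⟩]
    have : ∀ i, P (ξ n i ⁻¹' (S k)ᶜ) = volume (S k)ᶜ := fun i => by
      rw [← (hlaw n i).map_eq,
        Measure.map_apply_of_aemeasurable (hlaw n i).aemeasurable (hS k).compl]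
    simp only [this, Finset.prod_const, Finset.card_univ, Fintype.card_fin]
  have hlim : Tendsto (fun n : ℕ => ∑ k ∈ Finset.range K, volume (S k)ᶜ ^ n) atTop (𝓝 0) := by
    simpa using tendsto_finsetSum (Finset.range K) fun k hk =>
      ENNReal.tendsto_pow_atTop_nhds_zero_of_lt_one
        (measure_interval_compl_lt_one (Finset.mem_range.1 hk))
  refine tendsto_of_tendsto_of_tendsto_of_le_of_le tendsto_const_nhds hlim (fun _ => zero_le)
    fun n => ?_
  have hsub : {ω | ¬ FineGrid K fun i => ξ n i ω} ⊆
      ⋃ k ∈ Finset.range K, ⋂ i, ξ n i ⁻¹' (S k)ᶜ := fun ω hω => by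
    simp only [FineGrid, Set.mem_ofPred_eq, not_forall, not_exists] at hω
    obtain ⟨k, hk, hω⟩ := hω
    exact Set.mem_biUnion (Finset.mem_coe.2 (Finset.mem_range.2 hk)) (Set.mem_iInter.2 hω)
  refine (measure_mono hsub).trans ((measure_biUnion_finset_le _ _).trans ?_)
  simp only [hmiss, le_refl]

theorem fixedGrid_monotone (n : ℕ) : Monotone (fixedGrid n) := fun _ _ hij =>
  Subtype.coe_le_coe.1 (div_le_div_of_nonneg_right (Nat.cast_le.2 hij) (Nat.cast_nonneg n))

end IGN

end

theorem mainTheorem4 {d m d' : ℕ} (W : IGN.Graphon)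
    (X : unitInterval → EuclideanSpace ℝ (Fin d)) (Φ : IGN.CIGN (1 + d) m d') (A₁ A₂ A₃ : ℝ)
    (hW : ∀ u₁ v₁ u₂ v₂ : unitInterval, |W.toFun u₂ v₂ - W.toFun u₁ v₁| ≤
      A₁ * (|(u₂ : ℝ) - (u₁ : ℝ)| + |(v₂ : ℝ) - (v₁ : ℝ)|))
    (hfilter : Φ.FilterBound A₂)
    (hX : ∀ u v : unitInterval, ‖X u - X v‖ ≤ A₃ * |(u : ℝ) - (v : ℝ)|)
    (hact : Φ.NormalizedLipschitz) :
    Tendsto (fun n : ℕ => Φ.error W X (IGN.fixedGrid n)) atTop (𝓝 0) ∧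
    ∀ (Ω : Type*) [MeasurableSpace Ω] (P : Measure Ω) [IsProbabilityMeasure P]
      (ξ : (n : ℕ) → Fin n → Ω → unitInterval),
      (∀ n i, HasLaw (ξ n i) volume P) →
      (∀ n, iIndepFun (ξ n) P) →
      ∀ ε : ℝ≥0∞, 0 < ε →
        Tendsto (fun n : ℕ => P {ω | ε ≤ Φ.error W X (IGN.orderStat (fun i => ξ n i ω))})
          atTop (𝓝 0) := by
  have hXc : Continuous X := (LipschitzWith.of_dist_le' (K := A₃) fun u v => by
    simpa [dist_eq_norm, Subtype.dist_eq] using hX u v).continuous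
  have hWc : Continuous (Function.uncurry W.toFun) := by
    refine continuous_iff_continuousAt.2 fun p => tendsto_iff_dist_tendsto_zero.2 ?_
    have hlim : Tendsto (fun q : unitInterval × unitInterval =>
        A₁ * (|(q.1 : ℝ) - (p.1 : ℝ)| + |(q.2 : ℝ) - (p.2 : ℝ)|)) (𝓝 p) (𝓝 0) := by
      have : Continuous fun q : unitInterval × unitInterval =>
        A₁ * (|(q.1 : ℝ) - (p.1 : ℝ)| + |(q.2 : ℝ) - (p.2 : ℝ)|) := by fun_prop
      simpa using this.tendsto p
    exact squeeze_zero (fun _ => dist_nonneg) (fun q => hW _ _ _ _) hlim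
  have hgrid := fun {ε : ℝ≥0∞} (hε : 0 < ε) =>
    Φ.exists_forall_fineGrid_error_lt hact W hWc hXc hε
  refine ⟨?_, fun Ω _ P _ ξ hlaw hind ε hε => ?_⟩
  · refine tendsto_order.2 ⟨fun a ha => absurd ha not_lt_zero, fun ε hε => ?_⟩
    obtain ⟨K, hK⟩ := hgrid hε
    filter_upwards [eventually_ge_atTop K] with n hn
    exact hK n _ (IGN.fixedGrid_monotone n) (IGN.fineGrid_fixedGrid hn)
  · obtain ⟨K, hK⟩ := hgrid hε
    refine tendsto_of_tendsto_of_tendsto_of_le_of_le tendsto_const_nhds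
      (IGN.tendsto_measure_not_fineGrid P ξ hlaw hind K) (fun _ => zero_le) fun n =>
      measure_mono fun ω hω hfine => ?_
    exact not_lt.2 hω (hK n _ (Tuple.monotone_sort _) hfine.orderStat)
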